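/- Let $\mathbb{N}=\{1,2,3,\dots\}$, let $\alpha>0$ and $0<\gamma<1$, and put $g_{\alpha,\gamma}(n)=\lfloor n\alpha+\gamma\rfloor$ for $n\in\mathbb{N}$. For $A\subseteq\mathbb{N}$ write $g_{\alpha,\gamma}[A]=\{g_{\alpha,\gamma}(n):n\in A\}\cap\mathbb{N}$ (only the value $0$, which can occur when $\alpha<1$, is discarded), and for a collection $\mathcal{F}$ of subsets of $\mathbb{N}$ write $g_{\alpha,\gamma}[\mathcal{F}]=\{g_{\alpha,\gamma}[A]:A\in\mathcal{F}\}$. Let $\mathcal{F}$ be any one of the following collections of sets $A\subseteq\mathbb{N}$: - $\mathcal{IF}$: the infinite sets; - $\mathcal{AP}$: the sets that contain arithmetic progressions, with positive common difference, of every finite length; - $\mathcal{PS}$: the piecewise syndetic sets, that is, those for which there is a finite nonempty $G\subseteq\mathbb{N}$ such that for every finite nonempty $E\subseteq\mathbb{N}$ there is $x\in\mathbb{N}$ with $E+x\subseteq\bigcup_{t\in G}(-t+A)$, where $-t+A=\{s\in\mathbb{N}:t+s\in A\}$; - $\mathcal{HSD}$: the sets with $\sum_{n\in A}\frac1n=\infty$;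 - $\mathcal{J}$: the $J$-sets, that is, those such that for every finite nonempty set $E$ of sequences $f:\mathbb{N}\to\mathbb{N}$ there are $a\in\mathbb{N}$ and a finite nonempty $H\subseteq\mathbb{N}$ with $a+\sum_{n\in H}f(n)\in A$ for all $f\in E$; - $\mathcal{PUAD}$: the sets of positive upper asymptotic density, $\limsup_{n\to\infty}\frac{|A\cap\{1,\dots,n\}|}{n}>0$; - $\mathcal{PUBD}$: the sets of positive upper Banach density, $\limsup_{n-m\to\infty}\frac{|A\cap\{m+1,\dots,n\}|}{n-m}>0$. Then $g_{\alpha,\gamma}[\mathcal{F}]\subseteq\mathcal{F}$; that is, if $A\in\mathcal{F}$ then $g_{\alpha,\gamma}[A]\in\mathcal{F}$. -/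

import Mathlib

open scoped ENNReal

namespace NonhomSpectra

/-- The function `g_{α,γ}(n) = ⌊n α + γ⌋` on the positive integers. For `α, γ > 0` its values are
nonnegative integers; the value `0` is possible when `α < 1`. -/
noncomputable def g (α γ : ℝ) (n : ℕ+) : ℕ := ⌊((n : ℕ) : ℝ) * α + γ⌋₊

/-- The image `g_{α,γ}[A]`, as a set of positive integers (a possible value `0` is dropped). -/
def gImage (α γ : ℝ) (A : Set ℕ+) : Set ℕ+ := {m : ℕ+ | ∃ n ∈ A, g α γ n = (m : ℕ)}

/-- The infinite sets. -/
def IF : Set (Set ℕ+) := {A | A.Infinite}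

/-- The sets containing arithmetic progressions (of positive difference) of every finite length. -/
def AP : Set (Set ℕ+) :=
  {A | ∀ k : ℕ, ∃ a d : ℕ+, ∀ i < k, ∃ b ∈ A, (b : ℕ) = (a : ℕ) + i * (d : ℕ)}

/-- The piecewise syndetic sets: for some finite nonempty `G`, every finite nonempty `F` has a
translate `F + x` inside `⋃ t ∈ G, (-t + A)`, where `-t + A = {s | t + s ∈ A}`. -/
def PS : Set (Set ℕ+) :=
  {A | ∃ G : Finset ℕ+, G.Nonempty ∧ ∀ F : Finset ℕ+, F.Nonempty →
    ∃ x : ℕ+, ∀ y ∈ F, ∃ t ∈ G, t + (y + x) ∈ A}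

/-- The sets whose harmonic sum diverges. -/
def HSD : Set (Set ℕ+) := {A | ∑' n : A, (((n : ℕ+) : ℕ) : ℝ≥0∞)⁻¹ = ⊤}

/-- The `J`-sets: for every finite nonempty set `F` of sequences of positive integers there are a
positive integer `a` and a finite nonempty set `H` of indices such that `a + ∑ n ∈ H, f n ∈ A` for
all `f ∈ F`. The sum is computed in `ℕ`, as the positive integers have no zero. -/
def J : Set (Set ℕ+) :=
  {A | ∀ F : Finset (ℕ+ → ℕ+), F.Nonempty → ∃ (a : ℕ+) (H : Finset ℕ+), H.Nonempty ∧
    ∀ f ∈ F, ∃ b ∈ A, (b : ℕ) = (a : ℕ) + ∑ n ∈ H, (f n : ℕ)}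

/-- The upper asymptotic density `limsup_{n → ∞} |A ∩ {1, …, n}| / n`. -/
noncomputable def upperAsymptoticDensity (A : Set ℕ+) : ℝ :=
  Filter.limsup (fun n : ℕ+ => ((A ∩ Set.Icc 1 n).ncard : ℝ) / ((n : ℕ) : ℝ)) Filter.atTop

/-- The upper Banach density `limsup_{n - m → ∞} |A ∩ {m + 1, …, n}| / (n - m)`. -/
noncomputable def upperBanachDensity (A : Set ℕ+) : ℝ :=
  Filter.limsup
    (fun p : ℕ+ × ℕ+ =>
      ((A ∩ Set.Ioc p.1 p.2).ncard : ℝ) / (((p.2 : ℕ) : ℝ) - ((p.1 : ℕ) : ℝ)))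
    (Filter.comap (fun p : ℕ+ × ℕ+ => ((p.2 : ℕ) : ℝ) - ((p.1 : ℕ) : ℝ)) Filter.atTop)

/-- The sets of positive upper asymptotic density. -/
def PUAD : Set (Set ℕ+) := {A | 0 < upperAsymptoticDensity A}

/-- The sets of positive upper Banach density. -/
def PUBD : Set (Set ℕ+) := {A | 0 < upperBanachDensity A}

end NonhomSpectra

namespace NonhomSpectra

/-! ### Fibres of the floor map. -/

section Basic

/-! `g α γ` is monotone, within distance one of the line `nα + γ`, and has fibres of at most
`fibreBound α` elements. For families measuring size this is enough. Bounded fibres keep infinite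
sets infinite (`injective_g_mod`); linear growth shows that harmonic sums and densities lose only a
constant factor (`ncard_le_fibreBound_mul`); and bounded steps carry bounded gaps to bounded gaps,
which gives the piecewise syndetic case.

The additive families `AP` and `J` need Diophantine approximation, since `g α γ` is only additive up
to rounding. For `AP`, Dirichlet's theorem thins the progression until its step times `α` is nearly
an integer. The small drift then crosses at most one integer, so half of the terms have an image
that is exactly a progression.

For `J`, sums of each target sequence over long blocks are made nearly equal, up to a common integer
shift, to multiples of `α`, with errors of a prescribed sign and geometrically small. The
multipliers are the sequences to which the `J`-property of `A` is applied. The total error is at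
most 1/4, and its sign is chosen so that rounding is not disturbed
(`exists_block_sum_near_mul_signed`). -/

lemma exists_pnat_gt (r : ℝ) : ∃ k : ℕ+, r < ((k : ℕ) : ℝ) := by
  obtain ⟨n, hn⟩ := exists_nat_gt r
  exact ⟨n.succPNat, hn.trans (by simp)⟩

variable {α γ : ℝ}

lemma g_le (hα : 0 < α) (hγ₀ : 0 < γ) (n : ℕ+) : (g α γ n : ℝ) ≤ ((n : ℕ) : ℝ) * α + γ :=
  Nat.floor_le (by positivity)

lemma lt_g_add_one (n : ℕ+) : ((n : ℕ) : ℝ) * α + γ < g α γ n + 1 :=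
  Nat.lt_floor_add_one _

lemma g_mono (hα : 0 < α) {m n : ℕ+} (h : m ≤ n) : g α γ m ≤ g α γ n := by
  have : ((m : ℕ) : ℝ) ≤ ((n : ℕ) : ℝ) := by exact_mod_cast h
  exact Nat.floor_mono (by gcongr)

lemma mul_lt_of_g_eq (hα : 0 < α) (hγ₀ : 0 < γ) {m n : ℕ+} (h : g α γ m = g α γ n) :
    ((m : ℕ) : ℝ) * α < (n : ℕ) * α + 1 := by
  have h1 := lt_g_add_one (α := α) (γ := γ) m
  have h2 := g_le hα hγ₀ n
  rw [h] at h1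
  linarith

/-- A bound for the number of elements in a fibre of `g α γ`. -/
noncomputable def fibreBound (α : ℝ) : ℕ := ⌊α⁻¹⌋₊ + 1

lemma fibreBound_pos (α : ℝ) : 0 < fibreBound α := Nat.succ_pos _

/-- Two elements of one fibre differ by less than `1/α`, hence by less than `fibreBound α`, so their
residues separate them. -/
lemma injective_g_mod (hα : 0 < α) (hγ₀ : 0 < γ) :
    Function.Injective fun n : ℕ+ => (g α γ n, (n : ℕ) % fibreBound α) := by
  intro m n h
  wlog hmn : n ≤ m generalizing m n
  · exact (this h.symm (le_of_not_ge hmn)).symm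
  obtain ⟨hg, hmod⟩ := Prod.mk.inj h
  have h1 := mul_lt_of_g_eq hα hγ₀ hg
  have hle : (n : ℕ) ≤ m := by exact_mod_cast hmn
  have h2 : (((m : ℕ) - (n : ℕ) : ℕ) : ℝ) < fibreBound α := by
    rw [Nat.cast_sub hle, fibreBound, Nat.cast_add, Nat.cast_one]
    refine lt_trans ?_ (Nat.lt_floor_add_one α⁻¹)
    rw [← one_div, lt_div_iff₀ hα]
    linarith
  have h3 : (m : ℕ) - n < fibreBound α := by exact_mod_cast h2
  have h4 : fibreBound α ∣ (m : ℕ) - n := (Nat.modEq_iff_dvd' hle).1 (Eq.symm hmod)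
  have h5 := Nat.eq_zero_of_dvd_of_lt h4 h3
  exact PNat.eq (by omega)

lemma ncard_le_fibreBound_mul (hα : 0 < α) (hγ₀ : 0 < γ) {S W : Set ℕ+} (hW : W.Finite)
    (E : Finset ℕ) (h : ∀ k ∈ S, g α γ k ∈ E ∨ ∃ w ∈ W, g α γ k = (w : ℕ)) :
    S.ncard ≤ (E.card + W.ncard) * fibreBound α := by
  classical
  lift W to Finset ℕ+ using hW
  rw [Set.ncard_coe_finset]
  have hmaps : Set.MapsTo (fun n : ℕ+ => (g α γ n, (n : ℕ) % fibreBound α)) S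
      (((E ∪ W.image fun w : ℕ+ => (w : ℕ)) ×ˢ Finset.range (fibreBound α) : Finset (ℕ × ℕ)) :
        Set (ℕ × ℕ)) := by
    intro k hk
    simp only [Finset.coe_product, Set.mem_prod, Finset.mem_coe, Finset.mem_union,
      Finset.mem_image, Finset.mem_range]
    refine ⟨?_, Nat.mod_lt _ (fibreBound_pos α)⟩
    rcases h k hk with h | ⟨w, hw, h⟩
    exacts [Or.inl h, Or.inr ⟨w, hw, h.symm⟩]
  refine (Set.ncard_le_ncard_of_injOn _ hmaps (injective_g_mod hα hγ₀).injOn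
    (Finset.finite_toSet _)).trans ?_
  rw [Set.ncard_coe_finset, Finset.card_product, Finset.card_range]
  exact Nat.mul_le_mul_right _ ((Finset.card_union_le _ _).trans
    (Nat.add_le_add_left Finset.card_image_le _))

end Basic

/-! ### Infinite, piecewise syndetic and divergent-harmonic-sum sets. -/

section Families

variable {α γ : ℝ} {A : Set ℕ+}

lemma mem_gImage_of_pos {n : ℕ+} (hn : n ∈ A) (h : 0 < g α γ n) :
    (⟨g α γ n, h⟩ : ℕ+) ∈ gImage α γ A := ⟨n, hn, rfl⟩

lemma exists_mem_gImage {n : ℕ+} (hn : n ∈ A) (h : 0 < g α γ n) :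
    ∃ w ∈ gImage α γ A, (w : ℕ) = g α γ n := ⟨_, mem_gImage_of_pos hn h, rfl⟩

theorem gImage_mem_IF (hα : 0 < α) (hγ₀ : 0 < γ) (hA : A ∈ IF) : gImage α γ A ∈ IF := by
  intro hfin
  have hA' : A.Infinite := hA
  refine hA' (Set.Finite.of_finite_image (f := fun n : ℕ+ => (g α γ n, (n : ℕ) % fibreBound α))
    (Set.Finite.subset (((hfin.image fun w : ℕ+ => (w : ℕ)).union (Set.finite_singleton 0)).prod
      (Set.finite_lt_nat (fibreBound α))) ?_) (injective_g_mod hα hγ₀).injOn)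
  rintro _ ⟨n, hn, rfl⟩
  refine ⟨?_, Nat.mod_lt _ (fibreBound_pos α)⟩
  rcases Nat.eq_zero_or_pos (g α γ n) with h | h
  · exact Or.inr h
  · exact Or.inl ⟨_, mem_gImage_of_pos hn h, rfl⟩

theorem gImage_mem_PS (hα : 0 < α) (hγ₀ : 0 < γ) (hγ₁ : γ < 1) (hA : A ∈ PS) :
    gImage α γ A ∈ PS := by
  obtain ⟨G, hG, hA⟩ := hA
  obtain ⟨K, hK⟩ : ∃ K : ℕ+, ∀ t ∈ G, t ≤ K := G.exists_le
  -- Below, `g n ≤ (t + v)α + γ < z + 2 + α + Kα` with `t ≤ K`, so `K'` bounds the overshoot past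
  -- `z`, independently of `E`.
  obtain ⟨K', hK'⟩ := exists_pnat_gt (2 + α + (K : ℕ) * α)
  refine ⟨Finset.Icc 1 K', ⟨1, by simp⟩, fun E _ => ?_⟩
  obtain ⟨M, hM⟩ : ∃ M : ℕ+, ∀ t ∈ E, t ≤ M := E.exists_le
  obtain ⟨L, hL⟩ := exists_pnat_gt (((M : ℕ) + 3 : ℝ) / α + 1)
  obtain ⟨x, hx⟩ := hA (Finset.Icc 1 L) ⟨1, by simp⟩
  -- The successor is used because `g α γ x` may be 0.
  refine ⟨(g α γ x).succPNat, fun y hy => ?_⟩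
  set z : ℕ := y + (g α γ x + 1) with hz
  have hxg := g_le hα hγ₀ x
  have hxg' := lt_g_add_one (α := α) (γ := γ) x
  have hzr : (z : ℝ) = (y : ℕ) + ((g α γ x : ℝ) + 1) := by rw [hz]; push_cast; ring
  have hy1 : (1 : ℝ) ≤ (y : ℕ) := by exact_mod_cast y.pos
  have hyM : ((y : ℕ) : ℝ) ≤ (M : ℕ) := by exact_mod_cast hM y hy
  -- The least `v` with `vα ≥ z + 1`. It lies in the window `(x, x + L]`, so `A` meets `v + G`, and
  -- the image of such a point lands just above `z`.
  set v : ℕ := ⌈((z : ℝ) + 1) / α⌉₊ with hv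
  have hv1 : (z : ℝ) + 1 ≤ v * α := (div_le_iff₀ hα).1 (Nat.le_ceil _)
  have hv2 : (v : ℝ) * α < z + 1 + α := by
    have := Nat.ceil_lt_add_one (a := ((z : ℝ) + 1) / α) (by positivity)
    have := mul_lt_mul_of_pos_right this hα
    rw [add_mul, div_mul_cancel₀ _ hα.ne'] at this
    linarith
  have hxv : (x : ℕ) < v := by
    have : ((x : ℕ) : ℝ) * α < v * α := by linarith
    exact_mod_cast lt_of_mul_lt_mul_right this hα.le
  have hvL : v - (x : ℕ) ≤ L := by
    have h1 : ((v : ℝ) - (x : ℕ)) * α < L * α := by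
      have := mul_lt_mul_of_pos_right hL hα
      rw [add_mul, div_mul_cancel₀ _ hα.ne'] at this
      nlinarith
    have h2 := lt_of_mul_lt_mul_right h1 hα.le
    have h3 : (v : ℝ) < (L + x : ℕ) := by push_cast; linarith
    have : v < L + x := by exact_mod_cast h3
    omega
  obtain ⟨u, hu⟩ : ∃ u : ℕ+, (u : ℕ) = v - x := ⟨⟨v - x, by omega⟩, rfl⟩
  obtain ⟨t, ht, htA⟩ := hx u (Finset.mem_Icc.2 ⟨one_le, by rw [← PNat.coe_le_coe]; omega⟩)
  set n : ℕ+ := t + (u + x) with hn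
  have hnv : (n : ℕ) = t + v := by
    rw [hn, PNat.add_coe, PNat.add_coe]; omega
  have hnr : ((n : ℕ) : ℝ) = (t : ℕ) + v := by rw [hnv]; push_cast; ring
  have htK : ((t : ℕ) : ℝ) ≤ (K : ℕ) := by exact_mod_cast hK t ht
  have ht0 : (0 : ℝ) < (t : ℕ) := by exact_mod_cast t.pos
  have hng := g_le hα hγ₀ n
  have hng' := lt_g_add_one (α := α) (γ := γ) n
  rw [hnr] at hng hng'
  have hlow : z < g α γ n := by
    have : (z : ℝ) < g α γ n := by nlinarith
    exact_mod_cast this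
  have hhigh : g α γ n ≤ z + K' := by
    have : (g α γ n : ℝ) ≤ (z + K' : ℕ) := by push_cast; nlinarith
    exact_mod_cast this
  obtain ⟨d, hd⟩ : ∃ d : ℕ+, (d : ℕ) = g α γ n - z := ⟨⟨g α γ n - z, by omega⟩, rfl⟩
  refine ⟨d, Finset.mem_Icc.2 ⟨one_le, by rw [← PNat.coe_le_coe]; omega⟩, n, htA, ?_⟩
  rw [PNat.add_coe, PNat.add_coe, Nat.succPNat_coe]
  omega

/-- Since `g n ≤ (α + 1)n`, each term `1/n` is at most `(α + 1)/g n`, and each value of `g` is taken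
at most `fibreBound α` times. The fibre over 0, lost in the image, is finite. -/
theorem gImage_mem_HSD (hα : 0 < α) (hγ₀ : 0 < γ) (hγ₁ : γ < 1) (hA : A ∈ HSD) :
    gImage α γ A ∈ HSD := by
  have hA' : ∑' n : A, (((n : ℕ+) : ℕ) : ℝ≥0∞)⁻¹ = ⊤ := hA
  by_contra hB
  have hB' : ∑' n : gImage α γ A, (((n : ℕ+) : ℕ) : ℝ≥0∞)⁻¹ ≠ ⊤ := hB
  set C := fibreBound α with hC
  set S₀ : Set ℕ+ := {n | n ∈ A ∧ g α γ n = 0} with hS₀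
  set S₁ : Set ℕ+ := {n | n ∈ A ∧ 0 < g α γ n} with hS₁
  have hS₀fin : S₀.Finite := by
    refine Set.Finite.of_finite_image (f := fun n : ℕ+ => (g α γ n, (n : ℕ) % fibreBound α))
      (Set.Finite.subset ((Set.finite_singleton 0).prod (Set.finite_lt_nat (fibreBound α))) ?_)
      (injective_g_mod hα hγ₀).injOn
    rintro _ ⟨n, hn, rfl⟩
    exact ⟨hn.2, Nat.mod_lt _ (fibreBound_pos α)⟩
  have h₀ : ∑' n : S₀, (((n : ℕ+) : ℕ) : ℝ≥0∞)⁻¹ ≠ ⊤ := by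
    have := hS₀fin.fintype
    rw [tsum_fintype]
    exact ENNReal.sum_ne_top.2 fun n _ => ENNReal.inv_ne_top.2 (by simp)
  have h₁ : ∑' n : S₁, (((n : ℕ+) : ℕ) : ℝ≥0∞)⁻¹ ≠ ⊤ := by
    let φ : S₁ → gImage α γ A × Fin C := fun n =>
      (⟨⟨g α γ n, n.2.2⟩, mem_gImage_of_pos n.2.1 n.2.2⟩,
        ⟨(n : ℕ+) % C, Nat.mod_lt _ (fibreBound_pos α)⟩)
    have hφ : Function.Injective φ := by
      intro m n h
      have h1 : g α γ m = g α γ n := congrArg (fun p : gImage α γ A × Fin C => ((p.1 : ℕ+) : ℕ)) h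
      have h2 : ((m : ℕ+) : ℕ) % C = (n : ℕ+) % C := congrArg (fun p : gImage α γ A × Fin C => (p.2 : ℕ)) h
      exact Subtype.ext (injective_g_mod hα hγ₀ (Prod.ext h1 h2))
    let w : gImage α γ A × Fin C → ℝ≥0∞ := fun p =>
      ENNReal.ofReal (α + 1) * (((p.1 : ℕ+) : ℕ) : ℝ≥0∞)⁻¹
    have hle : ∀ n : S₁, (((n : ℕ+) : ℕ) : ℝ≥0∞)⁻¹ ≤ w (φ n) := by
      intro n
      have hg := g_le hα hγ₀ n.1
      have hn1 : (1 : ℝ) ≤ ((n : ℕ+) : ℕ) := by exact_mod_cast (n : ℕ+).pos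
      have hg0 : 0 < g α γ n := n.2.2
      have hgle : (g α γ n : ℝ) ≤ (α + 1) * ((n : ℕ+) : ℕ) := by nlinarith
      have hE : (g α γ n : ℝ≥0∞) ≤ ENNReal.ofReal (α + 1) * (((n : ℕ+) : ℕ) : ℝ≥0∞) := by
        rw [← ENNReal.ofReal_natCast, ← ENNReal.ofReal_natCast (n : ℕ+),
          ← ENNReal.ofReal_mul (by positivity)]
        exact ENNReal.ofReal_le_ofReal hgle
      show _ ≤ ENNReal.ofReal (α + 1) * (g α γ n : ℝ≥0∞)⁻¹
      rw [← div_eq_mul_inv, ENNReal.le_div_iff_mul_le (by simp [hg0.ne']) (by simp), mul_comm,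
        ← div_eq_mul_inv]
      exact ENNReal.div_le_of_le_mul hE
    refine ne_top_of_le_ne_top ?_ ((ENNReal.tsum_le_tsum hle).trans
      (ENNReal.tsum_comp_le_tsum_of_injective hφ w))
    rw [ENNReal.tsum_prod', ENNReal.tsum_comm, tsum_fintype]
    refine ENNReal.sum_ne_top.2 fun i _ => ?_
    rw [ENNReal.tsum_mul_left]
    exact ENNReal.mul_ne_top ENNReal.ofReal_ne_top hB'
  have hU : A = S₀ ∪ S₁ := by
    ext n
    simp only [hS₀, hS₁, Set.mem_union, Set.mem_ofPred_eq, ← and_or_left]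
    exact ⟨fun h => ⟨h, Nat.eq_zero_or_pos _⟩, fun h => h.1⟩
  have hle := ENNReal.tsum_union_le (fun n : ℕ+ => ((n : ℕ) : ℝ≥0∞)⁻¹) S₀ S₁
  rw [← hU, hA', top_le_iff, ENNReal.add_eq_top] at hle
  exact hle.elim h₀ h₁

end Families

/-! ### Upper asymptotic and upper Banach density. -/

section Density

open Filter

variable {α γ : ℝ} {A : Set ℕ+}

lemma ncard_inter_Icc_le (A : Set ℕ+) (n : ℕ+) : (A ∩ Set.Icc 1 n).ncard ≤ (n : ℕ) := by
  refine (Set.ncard_le_ncard Set.inter_subset_right (Set.finite_Icc _ _)).trans ?_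
  rw [← Finset.coe_Icc, Set.ncard_coe_finset, PNat.card_Icc]
  simp

lemma ncard_inter_Ioc_le (A : Set ℕ+) (m n : ℕ+) :
    (A ∩ Set.Ioc m n).ncard ≤ (n : ℕ) - (m : ℕ) := by
  refine (Set.ncard_le_ncard Set.inter_subset_right (Set.finite_Ioc _ _)).trans ?_
  rw [← Finset.coe_Ioc, Set.ncard_coe_finset, PNat.card_Ioc]

/-- The ratios lie in `[0, 1]`, so the real `limsup` is a genuine one and its positivity means a
frequent lower bound. -/
lemma mem_PUAD_iff : A ∈ PUAD ↔ ∃ c : ℝ, 0 < c ∧ ∀ L : ℕ+, ∃ n : ℕ+, L ≤ n ∧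
    c * (n : ℕ) ≤ ((A ∩ Set.Icc 1 n).ncard : ℝ) := by
  have hn0 (n : ℕ+) : (0 : ℝ) < (n : ℕ) := by exact_mod_cast n.pos
  constructor
  · intro h
    obtain ⟨c, hc, hcA⟩ := exists_between (show 0 < upperAsymptoticDensity A from h)
    have hfr := frequently_lt_of_lt_limsup
      (isCoboundedUnder_le_of_le (x := 0) _ fun n => by positivity) hcA
    refine ⟨c, hc, fun L => ?_⟩
    obtain ⟨n, hn, h⟩ := frequently_atTop.1 hfr L
    exact ⟨n, hn, ((lt_div_iff₀ (hn0 n)).1 h).le⟩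
  · rintro ⟨c, hc, h⟩
    refine lt_of_lt_of_le hc (le_limsup_of_frequently_le ?_ ?_)
    · refine frequently_atTop.2 fun L => ?_
      obtain ⟨n, hn, h⟩ := h L
      exact ⟨n, hn, (le_div_iff₀ (hn0 n)).2 h⟩
    · refine isBoundedUnder_of ⟨1, fun n => (div_le_one (hn0 n)).2 ?_⟩
      exact_mod_cast ncard_inter_Icc_le A n

lemma mem_PUBD_iff : A ∈ PUBD ↔ ∃ c : ℝ, 0 < c ∧ ∀ L : ℝ, ∃ m n : ℕ+,
    L ≤ (n : ℕ) - (m : ℕ) ∧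
    c * ((n : ℕ) - (m : ℕ)) ≤ ((A ∩ Set.Ioc m n).ncard : ℝ) := by
  set l := comap (fun p : ℕ+ × ℕ+ => ((p.2 : ℕ) : ℝ) - ((p.1 : ℕ) : ℝ)) atTop with hl
  have hpos : ∀ᶠ p in l, (0 : ℝ) < ((p.2 : ℕ) : ℝ) - ((p.1 : ℕ) : ℝ) :=
    tendsto_comap.eventually (eventually_gt_atTop 0)
  have : l.NeBot := by
    refine comap_neBot fun t ht => ?_
    obtain ⟨r, hr⟩ := mem_atTop_sets.1 ht
    obtain ⟨k, hk⟩ := exists_pnat_gt (r + 1)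
    exact ⟨(1, k), hr _ (by simp only [PNat.one_coe, Nat.cast_one]; linarith)⟩
  constructor
  · intro h
    obtain ⟨c, hc, hcA⟩ := exists_between (show 0 < upperBanachDensity A from h)
    have hfr := frequently_lt_of_lt_limsup
      (isCoboundedUnder_le_of_eventually_le (x := 0) _
        (hpos.mono fun p hp => div_nonneg (Nat.cast_nonneg _) hp.le)) hcA
    refine ⟨c, hc, fun L => ?_⟩
    obtain ⟨p, h, hp, hL⟩ := (hfr.and_eventually
      (hpos.and (tendsto_comap.eventually (eventually_ge_atTop L)))).exists
    exact ⟨p.1, p.2, hL, ((lt_div_iff₀ hp).1 h).le⟩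
  · rintro ⟨c, hc, h⟩
    refine lt_of_lt_of_le hc (le_limsup_of_frequently_le ?_ ?_)
    · refine frequently_comap.2 (frequently_atTop.2 fun L => ?_)
      obtain ⟨m, n, hL, h⟩ := h (max L 1)
      refine ⟨_, (le_max_left _ _).trans hL, (m, n), rfl, ?_⟩
      exact (le_div_iff₀ (one_pos.trans_le ((le_max_right _ _).trans hL))).2 h
    · refine isBoundedUnder_of_eventually_le (a := 1) (hpos.mono fun p hp => (div_le_one hp).2 ?_)
      have hlt : (p.1 : ℕ) < p.2 := by exact_mod_cast sub_pos.1 hp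
      rw [← Nat.cast_sub hlt.le]
      exact_mod_cast ncard_inter_Ioc_le A p.1 p.2

theorem gImage_mem_PUAD (hα : 0 < α) (hγ₀ : 0 < γ) (hγ₁ : γ < 1) (hA : A ∈ PUAD) :
    gImage α γ A ∈ PUAD := by
  obtain ⟨c, hc, h⟩ := mem_PUAD_iff.1 hA
  have hC : (0 : ℝ) < fibreBound α := by exact_mod_cast fibreBound_pos α
  set C : ℝ := ((fibreBound α : ℕ) : ℝ)
  refine mem_PUAD_iff.2 ⟨c / (2 * C * (α + 2)), by positivity, fun L => ?_⟩
  -- The term `2C/c` makes the fibre over 0, of size at most `C`, cost no more than half of the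
  -- count `cn`; the other term forces `N ≥ L`.
  obtain ⟨L', hL'⟩ := exists_pnat_gt (((L : ℕ) : ℝ) / α + 2 * C / c)
  obtain ⟨n, hn, hcard⟩ := h L'
  have hnr : ((L : ℕ) : ℝ) / α + 2 * C / c < (n : ℕ) :=
    hL'.trans_le (by exact_mod_cast hn)
  have hn1 : ((L : ℕ) : ℝ) / α < (n : ℕ) := lt_of_le_of_lt (by simp; positivity) hnr
  have hn2 : 2 * C / c < (n : ℕ) := lt_of_le_of_lt (by simp; positivity) hnr
  rw [div_lt_iff₀ hα] at hn1
  rw [div_lt_iff₀ hc] at hn2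
  have hn3 : (1 : ℝ) ≤ (n : ℕ) := by exact_mod_cast n.pos
  have hg := g_le hα hγ₀ n
  have hg' := lt_g_add_one (α := α) (γ := γ) n
  set N : ℕ+ := (g α γ n).succPNat with hN
  have hNr : ((N : ℕ) : ℝ) = g α γ n + 1 := by simp [hN]
  have hbound := ncard_le_fibreBound_mul hα hγ₀ (S := A ∩ Set.Icc 1 n)
    (W := gImage α γ A ∩ Set.Icc 1 N) ((Set.finite_Icc _ _).subset Set.inter_subset_right) {0} (by
      rintro k ⟨hkA, hk⟩
      rcases Nat.eq_zero_or_pos (g α γ k) with h0 | h0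
      · exact Or.inl (by simp [h0])
      · obtain ⟨w, hw, hwk⟩ := exists_mem_gImage hkA h0
        refine Or.inr ⟨w, ⟨hw, one_le, ?_⟩, hwk.symm⟩
        rw [← PNat.coe_le_coe, hN, Nat.succPNat_coe, hwk]
        exact (g_mono hα hk.2).trans (Nat.le_succ _))
  have hbound' : ((A ∩ Set.Icc 1 n).ncard : ℝ) ≤
      (1 + (gImage α γ A ∩ Set.Icc 1 N).ncard) * C := by
    rw [Finset.card_singleton] at hbound
    simp only [C]
    exact_mod_cast hbound
  refine ⟨N, ?_, ?_⟩
  · have : ((L : ℕ) : ℝ) ≤ (N : ℕ) := by rw [hNr]; linarith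
    exact_mod_cast this
  · rw [div_mul_eq_mul_div, div_le_iff₀ (by positivity)]
    have h1 : ((N : ℕ) : ℝ) ≤ (α + 2) * (n : ℕ) := by rw [hNr]; nlinarith
    have h2 : c * (n : ℕ) ≤ 2 * C * (gImage α γ A ∩ Set.Icc 1 N).ncard := by linarith
    calc c * (N : ℕ) ≤ c * ((α + 2) * (n : ℕ)) := by gcongr
      _ = (c * (n : ℕ)) * (α + 2) := by ring
      _ ≤ (2 * C * (gImage α γ A ∩ Set.Icc 1 N).ncard) * (α + 2) := by gcongr
      _ = _ := by ring

theorem gImage_mem_PUBD (hα : 0 < α) (hγ₀ : 0 < γ) (hA : A ∈ PUBD) :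
    gImage α γ A ∈ PUBD := by
  obtain ⟨c, hc, h⟩ := mem_PUBD_iff.1 hA
  have hC : (0 : ℝ) < fibreBound α := by exact_mod_cast fibreBound_pos α
  set C : ℝ := ((fibreBound α : ℕ) : ℝ)
  refine mem_PUBD_iff.2 ⟨c / (2 * C * (α + 1)), by positivity, fun L => ?_⟩
  obtain ⟨m, n, hmn, hcard⟩ := h (max 1 (max ((L + 1) / α) (4 * C / c)))
  have hn1 : (1 : ℝ) ≤ (n : ℕ) - (m : ℕ) := (le_max_left _ _).trans hmn
  have hn2 : (L + 1) / α ≤ (n : ℕ) - (m : ℕ) :=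
    ((le_max_left _ _).trans (le_max_right _ _)).trans hmn
  have hn3 : 4 * C / c ≤ (n : ℕ) - (m : ℕ) :=
    ((le_max_right _ _).trans (le_max_right _ _)).trans hmn
  rw [div_le_iff₀ hα] at hn2
  rw [div_le_iff₀ hc] at hn3
  have hgm := g_le hα hγ₀ m
  have hgm' := lt_g_add_one (α := α) (γ := γ) m
  have hgn := g_le hα hγ₀ n
  have hgn' := lt_g_add_one (α := α) (γ := γ) n
  set M : ℕ+ := (g α γ m).succPNat with hM
  have hMr : ((M : ℕ) : ℝ) = g α γ m + 1 := by simp [hM]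
  set N : ℕ+ := (g α γ n).succPNat with hN
  have hNr : ((N : ℕ) : ℝ) = g α γ n + 1 := by simp [hN]
  -- `Ioc M N` with `M = g m + 1` misses the two values `g m` and `g m + 1`. Their fibres hold at
  -- most `2C` elements, which the threshold `4C/c` absorbs.
  have hbound := ncard_le_fibreBound_mul hα hγ₀ (S := A ∩ Set.Ioc m n)
    (W := gImage α γ A ∩ Set.Ioc M N) ((Set.finite_Ioc _ _).subset Set.inter_subset_right)
    {g α γ m, g α γ m + 1} (by
      rintro k ⟨hkA, hk⟩
      have h1 := g_mono (γ := γ) hα hk.1.le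
      have h2 := g_mono (γ := γ) hα hk.2
      by_cases h0 : g α γ k ≤ g α γ m + 1
      · exact Or.inl (by simp only [Finset.mem_insert, Finset.mem_singleton]; omega)
      · obtain ⟨w, hw, hwk⟩ := exists_mem_gImage hkA (show 0 < g α γ k by omega)
        refine Or.inr ⟨w, ⟨hw, ?_, ?_⟩, hwk.symm⟩
        · rw [← PNat.coe_lt_coe, hM, Nat.succPNat_coe, hwk]
          exact not_le.1 h0
        · rw [← PNat.coe_le_coe, hN, Nat.succPNat_coe, hwk]
          exact h2.trans (Nat.le_succ _))
  have htwo : ({g α γ m, g α γ m + 1} : Finset ℕ).card = 2 := Finset.card_pair (by omega)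
  rw [htwo] at hbound
  have hbound' : ((A ∩ Set.Ioc m n).ncard : ℝ) ≤
      (2 + (gImage α γ A ∩ Set.Ioc M N).ncard) * C := by
    simp only [C]
    exact_mod_cast hbound
  refine ⟨M, N, ?_, ?_⟩
  · rw [hNr, hMr]; linarith
  · rw [div_mul_eq_mul_div, div_le_iff₀ (by positivity)]
    have h1 : ((N : ℕ) : ℝ) - (M : ℕ) ≤ (α + 1) * ((n : ℕ) - (m : ℕ)) := by
      rw [hNr, hMr]; linarith
    have h2 : c * ((n : ℕ) - (m : ℕ)) ≤ 2 * C * (gImage α γ A ∩ Set.Ioc M N).ncard := by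
      linarith
    calc c * ((N : ℕ) - (M : ℕ)) ≤ c * ((α + 1) * ((n : ℕ) - (m : ℕ))) := by gcongr
      _ = (c * ((n : ℕ) - (m : ℕ))) * (α + 1) := by ring
      _ ≤ (2 * C * (gImage α γ A ∩ Set.Ioc M N).ncard) * (α + 1) := by gcongr
      _ = _ := by ring

end Density

/-! ### Arithmetic progressions. -/

section Progressions

variable {α γ : ℝ} {A : Set ℕ+}

/-- The total drift over `2k` steps is at most 1, so at most one integer is crossed. If the first
half stays within one unit interval, take `j = 0`; otherwise the crossing has occurred by step `k`,
and `j = k` works. -/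
lemma exists_floor_const_on_half (y δ : ℝ) (k : ℕ) (h : |δ| * (2 * k) ≤ 1) :
    ∃ j ≤ k, ∃ e : ℤ, ∀ i ≤ k, (e : ℝ) ≤ y + (j + i : ℕ) * δ ∧ y + (j + i : ℕ) * δ < e + 1 := by
  have h0 := Int.floor_le y
  have h1 := Int.lt_floor_add_one y
  have hle : ∀ i ≤ k, (0 : ℝ) ≤ i ∧ (i : ℝ) ≤ k := fun i hi => ⟨by positivity, by exact_mod_cast hi⟩
  rcases le_total 0 δ with hδ | hδ
  · rw [abs_of_nonneg hδ] at h
    by_cases hk : y + k * δ < ⌊y⌋ + 1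
    · refine ⟨0, by omega, ⌊y⌋, fun i hi => ?_⟩
      obtain ⟨h2, h3⟩ := hle i hi
      push_cast
      constructor <;> nlinarith
    · refine ⟨k, le_rfl, ⌊y⌋ + 1, fun i hi => ?_⟩
      obtain ⟨h2, h3⟩ := hle i hi
      push_cast
      constructor <;> nlinarith
  · rw [abs_of_nonpos hδ] at h
    by_cases hk : ⌊y⌋ ≤ y + k * δ
    · refine ⟨0, by omega, ⌊y⌋, fun i hi => ?_⟩
      obtain ⟨h2, h3⟩ := hle i hi
      push_cast
      constructor <;> nlinarith
    · refine ⟨k, le_rfl, ⌊y⌋ - 1, fun i hi => ?_⟩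
      obtain ⟨h2, h3⟩ := hle i hi
      push_cast
      constructor <;> nlinarith

/-- Dirichlet approximation with positive numerator and bounded multiplier. -/
lemma exists_mul_sub_le {x : ℝ} (hx : 1 ≤ x) {N : ℕ} (hN : 0 < N) :
    ∃ q r : ℕ, 0 < q ∧ q ≤ N ∧ 0 < r ∧ |q * x - r| ≤ 1 / (N + 1) := by
  obtain ⟨q, hq, hqN, h⟩ := Real.exists_nat_abs_mul_sub_round_le x hN
  have hq1 : (1 : ℝ) ≤ q := by exact_mod_cast hq
  have hN1 : (1 : ℝ) / (N + 1) < 1 := by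
    rw [div_lt_one (by positivity)]
    have : (0 : ℝ) < N := by exact_mod_cast hN
    linarith
  have hr : 0 < round (q * x) := by
    have := (abs_le.1 h).2
    have : (0 : ℝ) < round (q * x) := by nlinarith
    exact_mod_cast this
  lift round (q * x) to ℕ using hr.le with r hr'
  exact ⟨q, r, hq, hqN, by exact_mod_cast hr, by exact_mod_cast h⟩

theorem gImage_mem_AP (hα : 0 < α) (hγ₀ : 0 < γ) (hA : A ∈ AP) : gImage α γ A ∈ AP := by
  intro k
  -- Passing to multiples of `M` makes the step times `α` at least 1, so the Dirichlet numerator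
  -- `r`, the new difference, is positive.
  obtain ⟨M, hM⟩ := exists_pnat_gt (1 / α)
  rw [div_lt_iff₀ hα] at hM
  obtain ⟨a, d, had⟩ := hA (2 * k * (M * (2 * k + 1)) + 1)
  have hd : (1 : ℝ) ≤ (d : ℕ) := by exact_mod_cast d.pos
  obtain ⟨q, r, hq, hqN, hr, hqr⟩ := exists_mul_sub_le (x := (d : ℕ) * ((M : ℕ) * α))
    (by nlinarith) (N := 2 * k + 1) (by omega)
  set δ : ℝ := q * ((d : ℕ) * ((M : ℕ) * α)) - r with hδ
  have hδ' : |δ| * (2 * k) ≤ 1 := by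
    push_cast at hqr
    rw [le_div_iff₀ (by positivity)] at hqr
    have := abs_nonneg δ
    nlinarith
  obtain ⟨j, hj, e, he⟩ := exists_floor_const_on_half ((a : ℕ) * α + γ) δ k hδ'
  have hval : ∀ i ≤ k, ∃ b ∈ A, (e + j * r + i * r : ℝ) ≤ (b : ℕ) * α + γ ∧
      ((b : ℕ) * α + γ : ℝ) < e + j * r + i * r + 1 := by
    intro i hi
    obtain ⟨b, hb, hbeq⟩ := had ((j + i) * (M * q))
      (Nat.lt_succ_of_le (Nat.mul_le_mul (by omega) (Nat.mul_le_mul_left _ hqN)))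
    obtain ⟨h1, h2⟩ := he i hi
    have : ((b : ℕ) : ℝ) * α + γ = (a : ℕ) * α + γ + (j + i : ℕ) * δ + (j + i) * r := by
      rw [hbeq, hδ]; push_cast; ring
    refine ⟨b, hb, ?_, ?_⟩ <;> rw [this] <;> linarith
  have hE : 0 ≤ e + j * r := by
    obtain ⟨b, -, -, h⟩ := hval 0 (Nat.zero_le _)
    have hb : 0 < ((b : ℕ) : ℝ) * α + γ := by positivity
    have : (0 : ℝ) < ((e + j * r + 1 : ℤ) : ℝ) := by push_cast at h ⊢; linarith
    have : 0 < e + j * r + 1 := by exact_mod_cast this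
    omega
  obtain ⟨E, hE⟩ := Int.eq_ofNat_of_zero_le hE
  have hEr : (e + j * r : ℝ) = E := by exact_mod_cast hE
  -- `E` may be 0, so the progression starts one term later.
  refine ⟨⟨E + r, by omega⟩, ⟨r, hr⟩, fun i hi => ?_⟩
  obtain ⟨b, hb, h1, h2⟩ := hval (i + 1) hi
  rw [hEr] at h1 h2
  have hg : g α γ b = E + r + i * r := by
    refine (Nat.floor_eq_iff (by positivity)).2 ⟨?_, ?_⟩ <;> push_cast at h1 h2 ⊢ <;> linarith
  exact ⟨⟨g α γ b, by omega⟩, mem_gImage_of_pos hb _, hg⟩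

end Progressions

/-! ### `J`-sets. -/

section JSets

variable {α γ : ℝ} {A : Set ℕ+}

/-- There are multiples of `α` slightly above and slightly below positive integers, such that every
sufficiently small element of `ℤ α + ℤ` is bounded by both errors (which vanish if `α` is
rational). -/
lemma exists_mul_near_int (hα : 0 < α) {ε : ℝ} (hε : 0 < ε) :
    ∃ c m c' m' : ℕ, ∃ η : ℝ, 0 < c ∧ 0 < m ∧ 0 < c' ∧ 0 < m' ∧ 0 < η ∧
      c * α - m < ε ∧ m' - c' * α < ε ∧
      ∀ h s : ℤ, |h * α - s| < η → |h * α - s| ≤ c * α - m ∧ |h * α - s| ≤ m' - c' * α := by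
  by_cases hirr : Irrational α
  · obtain ⟨M, hM⟩ := exists_pnat_gt (2 / α)
    rw [div_lt_iff₀ hα] at hM
    obtain ⟨N, hN⟩ := exists_pnat_gt (1 / min ε 1)
    have hε1 : 0 < min ε 1 := lt_min hε one_pos
    rw [div_lt_iff₀ hε1] at hN
    obtain ⟨q, r, hq, -, hr, hqr⟩ := exists_mul_sub_le (x := (M : ℕ) * α) (by linarith) N.pos
    set τ : ℝ := q * ((M : ℕ) * α) - r with hτ
    have hc : 0 < q * (M : ℕ) := Nat.mul_pos hq M.pos
    have hτc : τ = (q * (M : ℕ) : ℕ) * α - r := by rw [hτ]; push_cast; ring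
    have hirr' : ∀ (a b : ℕ), 0 < a → (a : ℝ) * α - b ≠ 0 := fun a b ha h =>
      ((hirr.natCast_mul ha.ne').ne_nat b) (sub_eq_zero.1 h)
    have hτ0 : τ ≠ 0 := hτc ▸ hirr' _ _ hc
    have hτε : |τ| < min ε 1 := by
      refine hqr.trans_lt ?_
      rw [div_lt_iff₀ (by positivity)]
      linarith
    have hτ1 : |τ| < ε := hτε.trans_le (min_le_left _ _)
    have hτ2 : |τ| < 1 := hτε.trans_le (min_le_right _ _)
    have hτpos : 0 < |τ| := abs_pos.2 hτ0
    -- `τ` supplies an error of one sign; `kτ` stops just short of `±1`, so shifting by one integer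
    -- gives an error of the other sign, smaller than `|τ|`.
    set k : ℕ := ⌊1 / |τ|⌋₊ with hk
    have hk1 : (k : ℝ) * |τ| ≤ 1 := (le_div_iff₀ hτpos).1 (Nat.floor_le (by positivity))
    have hk2 : 1 < ((k : ℝ) + 1) * |τ| := (div_lt_iff₀ hτpos).1 (Nat.lt_floor_add_one _)
    have hk0 : 0 < k := Nat.floor_pos.2 ((le_div_iff₀ hτpos).2 (by linarith))
    have hkc : 0 < k * (q * (M : ℕ)) := Nat.mul_pos hk0 hc
    have hkr : 0 < k * r := Nat.mul_pos hk0 hr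
    have hkτ : (k : ℝ) * τ = (k * (q * (M : ℕ)) : ℕ) * α - (k * r : ℕ) := by
      rw [hτc]; push_cast; ring
    rcases lt_or_gt_of_ne hτ0 with hneg | hpos
    · rw [abs_of_neg hneg] at hτ1 hτ2 hk1 hk2
      have hr1 : 1 < r := by
        have hq1 : (1 : ℝ) ≤ q := by exact_mod_cast hq
        have : (1 : ℝ) < r := by nlinarith
        exact_mod_cast this
      have hkr1 : 1 < k * r := hr1.trans_le (Nat.le_mul_of_pos_left r hk0)
      have hne := hirr' (k * (q * (M : ℕ))) (k * r - 1) hkc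
      have hσ : ((k * (q * (M : ℕ)) : ℕ) : ℝ) * α - (k * r - 1 : ℕ) = k * τ + 1 := by
        rw [hkτ, Nat.cast_sub hkr, Nat.cast_one]; ring
      rw [hσ] at hne
      have hσ0 : 0 < k * τ + 1 := lt_of_le_of_ne (by linarith) hne.symm
      refine ⟨_, _, q * (M : ℕ), r, min (k * τ + 1) (-τ), hkc, Nat.sub_pos_of_lt hkr1, hc, hr,
        lt_min hσ0 (by linarith), by rw [hσ]; linarith, by linarith, fun h s hs => ?_⟩
      rw [hσ]
      exact ⟨(hs.trans_le (min_le_left _ _)).le, by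
        have := (hs.trans_le (min_le_right _ _)).le; linarith⟩
    · rw [abs_of_pos hpos] at hτ1 hτ2 hk1 hk2
      have hne := hirr' (k * (q * (M : ℕ))) (k * r + 1) hkc
      have hσ : ((k * r + 1 : ℕ) : ℝ) - (k * (q * (M : ℕ)) : ℕ) * α = 1 - k * τ := by
        rw [hkτ]; push_cast; ring
      have hσ0 : 0 < 1 - k * τ := lt_of_le_of_ne (by linarith) fun h => hne (by linarith)
      refine ⟨q * (M : ℕ), r, _, _, min (1 - k * τ) τ, hc, hr, hkc, Nat.succ_pos _,
        lt_min hσ0 hpos, by linarith, by rw [hσ]; linarith, fun h s hs => ?_⟩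
      rw [hσ]
      exact ⟨by have := (hs.trans_le (min_le_right _ _)).le; linarith,
        (hs.trans_le (min_le_left _ _)).le⟩
  · obtain ⟨x, rfl⟩ := not_not.1 hirr
    have hx : 0 < x := by exact_mod_cast hα
    have hden : (0 : ℝ) < x.den := by exact_mod_cast x.den_pos
    have hnum : 0 < x.num := Rat.num_pos.2 hx
    have hxd : (x.den : ℝ) * (x : ℝ) = x.num := by exact_mod_cast Rat.den_mul_eq_num x
    obtain ⟨p, hp⟩ := Int.eq_ofNat_of_zero_le hnum.le
    have hxp : (x.den : ℝ) * (x : ℝ) = p := by rw [hxd, hp]; simp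
    -- Elements of `ℤα + ℤ` are multiples of `1/x.den`, so one below that size vanishes and both
    -- errors can be 0.
    refine ⟨x.den, p, x.den, p, 1 / x.den, x.den_pos, by omega, x.den_pos, by omega, by positivity,
      by rw [hxp]; simpa, by rw [hxp]; simpa, fun h s hs => ?_⟩
    have hz : (h * x - s : ℝ) * x.den = (h * p - s * x.den : ℤ) := by
      push_cast; rw [← hxp]; ring
    rw [lt_div_iff₀ hden, ← abs_of_pos hden, ← abs_mul, hz] at hs
    have : |h * (p : ℤ) - s * x.den| < 1 := by exact_mod_cast hs
    rw [Int.abs_lt_one_iff.1 this, Int.cast_zero, mul_eq_zero, or_iff_left hden.ne'] at hz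
    rw [hz, hxp]
    simp

/-- Simultaneous approximation of block sums by multiples of `α`. -/
lemma exists_block_sum_near_mul (hα : 0 < α) {ι : Type*} [Finite ι] (f : ι → ℕ → ℕ) (s : ℕ)
    {η : ℝ} (hη : 0 < η) :
    ∃ u t : ℕ, s ≤ u ∧ u < t ∧ ∃ h : ι → ℕ, ∀ i,
      |(h i : ℝ) * α - (∑ j ∈ Finset.Ioc u t, f i j : ℕ)| < η := by
  obtain ⟨N, hN⟩ := exists_pnat_gt (α / η)
  have hN0 : (0 : ℝ) < (N : ℕ) := by exact_mod_cast N.pos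
  rw [div_lt_iff₀ hη] at hN
  let P : ι → ℕ → ℝ := fun i t => (∑ j ∈ Finset.Ioc s t, f i j : ℕ) / α
  have hP0 : ∀ i t, 0 ≤ P i t := fun i t => by positivity
  -- Pigeonhole: the fractional parts of all partial sums divided by `α` are sorted into `N` boxes.
  -- Two times in the same boxes bound the block, and `h` is the difference of the integer parts.
  let κ : ℕ → ι → Fin N := fun t i =>
    ⟨⌊(N : ℕ) * Int.fract (P i (s + t))⌋₊, (Nat.floor_lt (by positivity)).2 (by
      have := Int.fract_lt_one (P i (s + t)); nlinarith)⟩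
  obtain ⟨u', t', hne, hκ⟩ := Finite.exists_ne_map_eq_of_infinite κ
  wlog hlt : u' < t' generalizing u' t'
  · exact this t' u' hne.symm hκ.symm (lt_of_le_of_ne (not_lt.1 hlt) hne.symm)
  have hsum : ∀ i, ((∑ j ∈ Finset.Ioc (s + u') (s + t'), f i j : ℕ) : ℝ) / α =
      P i (s + t') - P i (s + u') := by
    intro i
    have := Finset.sum_Ioc_consecutive (f i) (show s ≤ s + u' by omega)
      (show s + u' ≤ s + t' by omega)
    simp only [P, ← this, Nat.cast_add, add_div]
    ring
  have hPle : ∀ i, P i (s + u') ≤ P i (s + t') := fun i => by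
    rw [← sub_nonneg, ← hsum i]; positivity
  refine ⟨s + u', s + t', by omega, by omega,
    fun i => ⌊P i (s + t')⌋₊ - ⌊P i (s + u')⌋₊, fun i => ?_⟩
  have hfl : ⌊(N : ℕ) * Int.fract (P i (s + u'))⌋₊ = ⌊(N : ℕ) * Int.fract (P i (s + t'))⌋₊ :=
    congrArg Fin.val (congrFun hκ i)
  have hu1 := Nat.floor_le (mul_nonneg hN0.le (Int.fract_nonneg (P i (s + u'))))
  have hu2 := Nat.lt_floor_add_one ((N : ℕ) * Int.fract (P i (s + u')))
  have ht1 := Nat.floor_le (mul_nonneg hN0.le (Int.fract_nonneg (P i (s + t'))))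
  have ht2 := Nat.lt_floor_add_one ((N : ℕ) * Int.fract (P i (s + t')))
  rw [hfl] at hu1 hu2
  have hfr : |(N : ℕ) * (Int.fract (P i (s + u')) - Int.fract (P i (s + t')))| ≤ 1 := by
    rw [abs_le]; constructor <;> linarith
  have hS : ((∑ j ∈ Finset.Ioc (s + u') (s + t'), f i j : ℕ) : ℝ) =
      (P i (s + t') - P i (s + u')) * α := by rw [← hsum i, div_mul_cancel₀ _ hα.ne']
  have hfract : ∀ x : ℝ, 0 ≤ x → Int.fract x = x - ⌊x⌋₊ := fun x hx => by
    rw [Int.fract, natCast_floor_eq_intCast_floor hx]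
  have key : (((⌊P i (s + t')⌋₊ - ⌊P i (s + u')⌋₊ : ℕ) : ℝ) * α -
      (∑ j ∈ Finset.Ioc (s + u') (s + t'), f i j : ℕ)) =
      (Int.fract (P i (s + u')) - Int.fract (P i (s + t'))) * α := by
    rw [hS, Nat.cast_sub (Nat.floor_mono (hPle i)), hfract _ (hP0 _ _), hfract _ (hP0 _ _)]
    ring
  rw [key, abs_mul, abs_of_pos hα]
  rw [abs_mul, abs_of_pos hN0] at hfr
  have h1 := mul_le_mul_of_nonneg_right hfr hα.le
  refine lt_of_mul_lt_mul_left (a := ((N : ℕ) : ℝ)) ?_ hN0.le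
  nlinarith

/-- For finitely many sequences there are a later block and multiples of `α` exceeding, respectively
falling short of, the block sums by almost a common positive integer. -/
lemma exists_block_sum_near_mul_signed (hα : 0 < α) {ι : Type*} [Finite ι] (f : ι → ℕ → ℕ) (s : ℕ)
    {ε : ℝ} (hε : 0 < ε) :
    ∃ u t : ℕ, s ≤ u ∧ u < t ∧ ∃ (p q : ι → ℕ+) (m m' : ℕ), 0 < m ∧ 0 < m' ∧ ∀ i,
      (0 ≤ (p i : ℕ) * α - (m + ∑ j ∈ Finset.Ioc u t, f i j : ℕ) ∧
        (p i : ℕ) * α - (m + ∑ j ∈ Finset.Ioc u t, f i j : ℕ) ≤ ε) ∧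
      (0 ≤ (m' + ∑ j ∈ Finset.Ioc u t, f i j : ℕ) - (q i : ℕ) * α ∧
        (m' + ∑ j ∈ Finset.Ioc u t, f i j : ℕ) - (q i : ℕ) * α ≤ ε) := by
  obtain ⟨c, m, c', m', η, hc, hm, hc', hm', hη, h1, h2, hsmall⟩ :=
    exists_mul_near_int hα (half_pos hε)
  obtain ⟨u, t, hu, hut, h, hh⟩ := exists_block_sum_near_mul hα f s hη
  refine ⟨u, t, hu, hut, fun i => ⟨h i + c, by omega⟩, fun i => ⟨h i + c', by omega⟩, m, m', hm, hm',
    fun i => ?_⟩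
  -- The error of `h i` is dominated by that of `c` and of `c'`, so adding either fixes the sign for
  -- all `i` at once.
  obtain ⟨h3, h4⟩ := hsmall (h i) (∑ j ∈ Finset.Ioc u t, f i j : ℕ) (by exact_mod_cast hh i)
  rw [Int.cast_natCast, Int.cast_natCast] at h3 h4
  have h5 := abs_le.1 h3
  have h6 := abs_le.1 h4
  show (0 ≤ ((h i + c : ℕ) : ℝ) * α - (m + ∑ j ∈ Finset.Ioc u t, f i j : ℕ) ∧
      ((h i + c : ℕ) : ℝ) * α - (m + ∑ j ∈ Finset.Ioc u t, f i j : ℕ) ≤ ε) ∧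
    (0 ≤ (m' + ∑ j ∈ Finset.Ioc u t, f i j : ℕ) - ((h i + c' : ℕ) : ℝ) * α ∧
      (m' + ∑ j ∈ Finset.Ioc u t, f i j : ℕ) - ((h i + c' : ℕ) : ℝ) * α ≤ ε)
  rw [Nat.cast_add (h i) c, Nat.cast_add (h i) c', Nat.cast_add m, Nat.cast_add m']
  refine ⟨⟨?_, ?_⟩, ?_, ?_⟩ <;> linarith [h5.1, h5.2, h6.1, h6.2]

lemma exists_of_mem_J (hA : A ∈ J) {ι : Type*} [Finite ι] [Nonempty ι] (f : ι → ℕ → ℕ+) :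
    ∃ (a : ℕ+) (K : Finset ℕ), K.Nonempty ∧
      ∀ i, ∃ b ∈ A, (b : ℕ) = (a : ℕ) + ∑ n ∈ K, (f i n : ℕ) := by
  obtain ⟨a, H, hH, h⟩ := hA (Set.finite_range fun i (n : ℕ+) => f i n.natPred).toFinset
    (by rw [Set.Finite.toFinset_nonempty]; exact Set.range_nonempty _)
  refine ⟨a, H.image PNat.natPred, hH.image _, fun i => ?_⟩
  rw [Finset.sum_image PNat.natPred_injective.injOn]
  exact h (fun n => f i n.natPred) (by simp)

lemma mem_J_of_forall
    (h : ∀ F : Finset (ℕ+ → ℕ+), F.Nonempty → ∃ (a : ℕ+) (K : Finset ℕ), K.Nonempty ∧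
      ∀ f ∈ F, ∃ b ∈ A, (b : ℕ) = (a : ℕ) + ∑ n ∈ K, (f n.succPNat : ℕ)) : A ∈ J := by
  intro F hF
  obtain ⟨a, K, hK, h⟩ := h F hF
  refine ⟨a, K.image Nat.succPNat, hK.image _, fun f hf => ?_⟩
  rw [Finset.sum_image Nat.succPNat_injective.injOn]
  exact h f hf

lemma sum_half_pow_div_eight_le (K : Finset ℕ) : ∑ n ∈ K, (1 / 2 : ℝ) ^ n / 8 ≤ 1 / 4 := by
  obtain ⟨N, hN⟩ : ∃ N, K ⊆ Finset.range N := K.exists_nat_subset_range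
  have h1 := Finset.sum_le_sum_of_subset_of_nonneg (f := fun n => (1 / 2 : ℝ) ^ n) hN
    fun _ _ _ => by positivity
  have h2 := sum_geometric_two_le N
  rw [← Finset.sum_div]
  linarith

theorem gImage_mem_J (hα : 0 < α) (hγ₀ : 0 < γ) (hA : A ∈ J) : gImage α γ A ∈ J := by
  refine mem_J_of_forall fun F hF => ?_
  have : Nonempty F := hF.to_subtype
  let φ : F → ℕ → ℕ := fun f j => f.1 j.succPNat
  choose u t hu hut p q m m' hm hm' hpq using fun n s : ℕ =>
    exists_block_sum_near_mul_signed hα φ s (show (0 : ℝ) < (1 / 2) ^ n / 8 by positivity)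
  -- Each block starts after the previous one ends, which makes the blocks disjoint.
  let S : ℕ → ℕ := fun n => Nat.rec 0 t n
  have hS : ∀ n, S n < S (n + 1) := fun n => (hu n (S n)).trans_lt (hut n (S n))
  have hSmono : Monotone S := monotone_nat_of_le_succ fun n => (hS n).le
  let B : ℕ → Finset ℕ := fun n => Finset.Ioc (u n (S n)) (t n (S n))
  have hBS : ∀ n, ∀ x ∈ B n, S n < x ∧ x ≤ S (n + 1) := fun n x hx => by
    have := Finset.mem_Ioc.1 hx
    exact ⟨(hu n (S n)).trans_lt this.1, this.2⟩
  have hdisj : Pairwise (Function.onFun Disjoint B) := by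
    have hlt : ∀ i j, i < j → Disjoint (B i) (B j) := fun i j hij =>
      Finset.disjoint_left.2 fun x hi hj => absurd ((hBS i x hi).2.trans (hSmono hij))
        (not_le.2 (hBS j x hj).1)
    intro i j hij
    rcases lt_or_gt_of_ne hij with h | h
    exacts [hlt i j h, (hlt j i h).symm]
  -- Both signs are fed in together, because the fractional part of `aα + γ`, which decides between
  -- them, is known only once `a` is.
  obtain ⟨a, K, hK, hb⟩ := exists_of_mem_J hA (ι := F ⊕ F)
    (Sum.elim (fun f n => p n (S n) f) (fun f n => q n (S n) f))
  have hε := sum_half_pow_div_eight_le K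
  have hblock : ∀ f : F, ∑ x ∈ K.biUnion B, φ f x = ∑ n ∈ K, ∑ x ∈ B n, φ f x := fun f =>
    Finset.sum_biUnion (hdisj.set_pairwise _)
  have hHne : (K.biUnion B).Nonempty := by
    obtain ⟨n, hn⟩ := hK
    exact ⟨t n (S n), Finset.mem_biUnion.2 ⟨n, hn, Finset.right_mem_Ioc.2 (hut n (S n))⟩⟩
  set y : ℝ := (a : ℕ) * α + γ with hy
  have hy0 : 0 < y := by positivity
  have hy1 := Nat.floor_le hy0.le
  have hy2 := Nat.lt_floor_add_one y
  have key : ∀ (r : ℕ → F → ℕ+) (M : ℕ → ℕ), (∀ n, 0 < M n) →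
      (∀ f, ∃ b ∈ A, (b : ℕ) = (a : ℕ) + ∑ n ∈ K, (r n f : ℕ)) →
      (∀ f, (⌊y⌋₊ : ℝ) ≤
          y + ∑ n ∈ K, ((r n f : ℕ) * α - (M n + ∑ x ∈ B n, φ f x : ℕ)) ∧
        y + ∑ n ∈ K, ((r n f : ℕ) * α - (M n + ∑ x ∈ B n, φ f x : ℕ)) < ⌊y⌋₊ + 1) →
      ∃ (a : ℕ+) (K : Finset ℕ), K.Nonempty ∧ ∀ f ∈ F, ∃ b ∈ gImage α γ A,
        (b : ℕ) = (a : ℕ) + ∑ n ∈ K, (f n.succPNat : ℕ) := by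
    intro r M hM hr hσ
    have hMK : 0 < ∑ n ∈ K, M n := Finset.sum_pos (fun n _ => hM n) hK
    refine ⟨⟨⌊y⌋₊ + ∑ n ∈ K, M n, by omega⟩, K.biUnion B, hHne, fun f hf => ?_⟩
    obtain ⟨b, hbA, hb⟩ := hr ⟨f, hf⟩
    obtain ⟨h1, h2⟩ := hσ ⟨f, hf⟩
    have hbα : ((b : ℕ) : ℝ) * α + γ = y + ∑ n ∈ K, ((r n ⟨f, hf⟩ : ℕ) * α -
        (M n + ∑ x ∈ B n, φ ⟨f, hf⟩ x : ℕ)) +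
        (∑ n ∈ K, M n + ∑ x ∈ K.biUnion B, φ ⟨f, hf⟩ x : ℕ) := by
      rw [hblock, ← Finset.sum_add_distrib, Finset.sum_sub_distrib, ← Nat.cast_sum,
        ← Finset.sum_mul, hb, hy]
      push_cast
      ring
    have hg : g α γ b = ⌊y⌋₊ + ∑ n ∈ K, M n + ∑ x ∈ K.biUnion B, φ ⟨f, hf⟩ x := by
      refine (Nat.floor_eq_iff (by positivity)).2 ?_
      rw [hbα, add_assoc, Nat.cast_add ⌊y⌋₊]
      constructor <;> linarith
    obtain ⟨w, hw, hwb⟩ := exists_mem_gImage (α := α) (γ := γ) hbA (by omega)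
    exact ⟨w, hw, hwb.trans hg⟩
  -- A fractional part below 1/2 leaves room for an upward error of at most 1/4; otherwise there is
  -- room for a downward one.
  by_cases hθ : y < ⌊y⌋₊ + 1 / 2
  · refine key (fun n => p n (S n)) (fun n => m n (S n)) (fun n => hm n _)
      (fun f => hb (Sum.inl f)) fun f => ?_
    have h0 := Finset.sum_nonneg fun n (_ : n ∈ K) => (hpq n (S n) f).1.1
    have h1 := Finset.sum_le_sum fun n (_ : n ∈ K) => (hpq n (S n) f).1.2
    constructor <;> linarith
  · refine key (fun n => q n (S n)) (fun n => m' n (S n)) (fun n => hm' n _)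
      (fun f => hb (Sum.inr f)) fun f => ?_
    have h0 := Finset.sum_nonneg fun n (_ : n ∈ K) => (hpq n (S n) f).2.1
    have h1 := Finset.sum_le_sum fun n (_ : n ∈ K) => (hpq n (S n) f).2.2
    rw [Finset.sum_sub_distrib] at h0 h1
    rw [Finset.sum_sub_distrib]
    constructor <;> linarith

end JSets

end NonhomSpectra

theorem mainTheorem9 (α γ : ℝ) (hα : 0 < α) (hγ₀ : 0 < γ) (hγ₁ : γ < 1)
    (F : Set (Set ℕ+))
    (hF : F = NonhomSpectra.IF ∨ F = NonhomSpectra.AP ∨ F = NonhomSpectra.PS ∨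
      F = NonhomSpectra.HSD ∨ F = NonhomSpectra.J ∨ F = NonhomSpectra.PUAD ∨
      F = NonhomSpectra.PUBD) :
    NonhomSpectra.gImage α γ '' F ⊆ F := by
  rintro _ ⟨A, hA, rfl⟩
  rcases hF with rfl | rfl | rfl | rfl | rfl | rfl | rfl
  · exact NonhomSpectra.gImage_mem_IF hα hγ₀ hA
  · exact NonhomSpectra.gImage_mem_AP hα hγ₀ hA
  · exact NonhomSpectra.gImage_mem_PS hα hγ₀ hγ₁ hA
  · exact NonhomSpectra.gImage_mem_HSD hα hγ₀ hγ₁ hA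
  · exact NonhomSpectra.gImage_mem_J hα hγ₀ hA
  · exact NonhomSpectra.gImage_mem_PUAD hα hγ₀ hγ₁ hA
  · exact NonhomSpectra.gImage_mem_PUBD hα hγ₀ hA
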